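/- Let $\Delta=\{z\in\mathbb C:|z|<1\}$ and let $X=\Delta\times\mathbb C$. In what follows, a discrete subset of a complex manifold $M$ means a closed subset whose subspace topology is discrete. An exhaustion function on $M$ is a continuous function $\rho:M\to[0,\infty)$ such that $\{x:\rho(x)\le c\}$ is compact for every $c\ge 0$, and an automorphism of $M$ is a biholomorphic map $M\to M$. An infinite discrete subset $D\subset M$ is called weakly tame if for every exhaustion function $\rho$ on $M$ and every map $\zeta:D\to[0,\infty)$ there is an automorphism $\phi$ of $M$ with $\rho(\phi(x))\ge\zeta(x)$ for all $x\in D$. It is called strongly tame if for every injective map $f:D\to D$ there is an automorphism $\phi$ of $M$ with $\phi(x)=f(x)$ for all $x\in D$. Then: (1) There is no strongly tame discrete subset of $X$. (2) On the other hand, $X$ has many weakly tame discrete subsets: an infinite discrete subset $D\subset X$ is weakly tame if and only if its projection $\{z\in\Delta:\exists w,\ (z,w)\in D\}$ is a discrete subset of $\Delta$ and, for every $p\in\Delta$, the set $\{(z,w)\in D: z=p\}$ is finite. In particular, $S\times\{0\}$ is weakly tame in $X$ for every infinite discrete subset $S\subset\Delta$. Moreover, there are weakly tame discrete subsets $D_1,D_2\subset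 X$ such that no automorphism $\phi$ of $X$ satisfies $\phi(D_1)=D_2$. (3) There are a weakly tame discrete subset $D\subset X$ and a permutation $\sigma$ of $D$ such that no automorphism $\phi$ of $X$ satisfies $\phi(x)=\sigma(x)$ for all $x\in D$. -/

import Mathlib

open scoped Manifold ContDiff NNReal

/-- A discrete subset of a manifold in the sense of complex analysis: a closed subset whose
subspace topology is discrete (equivalently, a subset without accumulation points). -/
def IsDiscreteSubset {X : Type*} [TopologicalSpace X] (D : Set X) : Prop :=
  IsClosed D ∧ IsDiscrete D

/-- An exhaustion function: a continuous function whose sublevel sets are compact. -/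
structure IsExhaustion {X : Type*} [TopologicalSpace X] (ρ : X → ℝ≥0) : Prop where
  continuous : Continuous ρ
  isCompact_sublevel : ∀ c : ℝ≥0, IsCompact {x | ρ x ≤ c}

section ComplexManifold

variable {E H : Type*} [NormedAddCommGroup E] [NormedSpace ℂ E] [TopologicalSpace H]

/-- Holomorphic automorphisms (biholomorphic self-maps) of a complex manifold `X`. -/
abbrev HolAut (I : ModelWithCorners ℂ E H) (X : Type*) [TopologicalSpace X]
    [ChartedSpace H X] : Type _ :=
  Diffeomorph I I X X ω

/-- Weakly tame subsets of a complex manifold: infinite discrete subsets which automorphisms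
can push to infinity arbitrarily fast. -/
def IsWeaklyTame (I : ModelWithCorners ℂ E H) {X : Type*} [TopologicalSpace X]
    [ChartedSpace H X] (D : Set X) : Prop :=
  D.Infinite ∧ IsDiscreteSubset D ∧
    ∀ ρ : X → ℝ≥0, IsExhaustion ρ → ∀ ζ : D → ℝ≥0,
      ∃ φ : HolAut I X, ∀ x : D, ζ x ≤ ρ (φ x)

/-- Strongly tame subsets of a complex manifold: infinite discrete subsets all of whose
injective self-maps extend to automorphisms of the manifold. -/
def IsStronglyTame (I : ModelWithCorners ℂ E H) {X : Type*} [TopologicalSpace X]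
    [ChartedSpace H X] (D : Set X) : Prop :=
  D.Infinite ∧ IsDiscreteSubset D ∧
    ∀ f : D → D, Function.Injective f →
      ∃ φ : HolAut I X, ∀ x : D, φ (x : X) = (f x : X)

end ComplexManifold

/-- The open unit disc, as an open submanifold of `ℂ`. -/
def openUnitDisc : TopologicalSpace.Opens ℂ :=
  ⟨{z : ℂ | ‖z‖ < 1}, isOpen_lt continuous_norm continuous_const⟩

/-- The complex manifold `Δ × ℂ`, where `Δ` is the open unit disc. -/
abbrev DiscTimesC : Type := openUnitDisc × ℂ

/-- The model with corners of the product manifold `Δ × ℂ`. -/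
noncomputable abbrev modelDiscTimesC : ModelWithCorners ℂ (ℂ × ℂ) (ModelProd ℂ ℂ) :=
  𝓘(ℂ, ℂ).prod 𝓘(ℂ, ℂ)

/-! By Liouville's theorem an automorphism of `Δ × ℂ` permutes the fibres `{z} × ℂ`, and it is
affine on each of them (`HolAut.fst_eq`, `HolAut.snd_eq`). Over a compact part of the disc it
therefore grows at most linearly in `w`, so a set that can be pushed out at a quadratic rate has
only finitely many points there (`IsWeaklyTame.finite_inter`). Conversely, if the projection is
discrete with finite fibres, a shear `w ↦ w + h z`, with `h` interpolating large values on the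
projection, pushes the set out as far as desired.

The base map of an automorphism is rigid: by the Schwarz lemma it is the identity once it fixes two
points. A transposition that fixes two points of `D` over distinct base points and swaps two others
thus cannot extend. Strong tameness implies weak tameness, so it fails too. The number of points per
fibre distinguishes the inequivalent examples. -/

open Complex Metric Filter Topology

/-! ### Holomorphic self-maps of the disc with two fixed points -/

/-- The involution of the unit disc interchanging `0` and `p`. -/
noncomputable def discInvolution (p z : ℂ) : ℂ := (p - z) / (1 - starRingEnd ℂ p * z)

lemma one_sub_conj_mul_ne_zero {p z : ℂ} (hp : ‖p‖ < 1) (hz : ‖z‖ < 1) :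
    1 - starRingEnd ℂ p * z ≠ 0 := by
  intro h
  have h1 : starRingEnd ℂ p * z = 1 := (sub_eq_zero.mp h).symm
  have h2 : ‖p‖ * ‖z‖ = 1 := by simpa using congrArg norm h1
  nlinarith [norm_nonneg p, norm_nonneg z]

lemma norm_discInvolution_lt_one {p z : ℂ} (hp : ‖p‖ < 1) (hz : ‖z‖ < 1) :
    ‖discInvolution p z‖ < 1 := by
  have h0 : 0 < ‖1 - starRingEnd ℂ p * z‖ :=
    norm_pos_iff.mpr (one_sub_conj_mul_ne_zero hp hz)
  rw [discInvolution, norm_div, div_lt_one h0]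
  refine lt_of_pow_lt_pow_left₀ 2 h0.le ?_
  have key : ‖1 - starRingEnd ℂ p * z‖ ^ 2 - ‖p - z‖ ^ 2 = (1 - ‖p‖ ^ 2) * (1 - ‖z‖ ^ 2) := by
    simp only [← Complex.normSq_eq_norm_sq, Complex.normSq_apply, sub_re, sub_im, mul_re, mul_im,
      conj_re, conj_im, one_re, one_im]
    ring
  have hp2 : ‖p‖ ^ 2 < 1 := by nlinarith [norm_nonneg p]
  have hz2 : ‖z‖ ^ 2 < 1 := by nlinarith [norm_nonneg z]
  nlinarith [mul_pos (sub_pos.mpr hp2) (sub_pos.mpr hz2)]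

lemma discInvolution_discInvolution {p z : ℂ} (hp : ‖p‖ < 1) (hz : ‖z‖ < 1) :
    discInvolution p (discInvolution p z) = z := by
  have h1 := one_sub_conj_mul_ne_zero hp hz
  have h3 := one_sub_conj_mul_ne_zero hp (norm_discInvolution_lt_one hp hz)
  rw [discInvolution, div_eq_iff h3]
  simp only [discInvolution]
  generalize starRingEnd ℂ p = q at h1
  have h2 : (p - z) / (1 - q * z) * (1 - q * z) = p - z := div_mul_cancel₀ _ h1
  refine mul_right_cancel₀ h1 ?_
  linear_combination (q * z - 1) * h2

lemma differentiableOn_discInvolution {p : ℂ} (hp : ‖p‖ < 1) :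
    DifferentiableOn ℂ (discInvolution p) (ball 0 1) := by
  intro z hz
  have h1 := one_sub_conj_mul_ne_zero hp (mem_ball_zero_iff.mp hz)
  have : DifferentiableAt ℂ (discInvolution p) z := by
    unfold discInvolution
    fun_prop (disch := exact h1)
  exact this.differentiableWithinAt

/-- Conjugation by the involution moves `p` to `0`; the second fixed point then gives equality in
the Schwarz lemma. -/
lemma eqOn_id_of_two_fixedPoints {g : ℂ → ℂ} (hg : DifferentiableOn ℂ g (ball 0 1))
    (hm : Set.MapsTo g (ball 0 1) (ball 0 1)) {p q : ℂ} (hp : ‖p‖ < 1) (hq : ‖q‖ < 1)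
    (hpq : p ≠ q) (hgp : g p = p) (hgq : g q = q) : Set.EqOn g id (ball 0 1) := by
  have hmaps : Set.MapsTo (discInvolution p) (ball 0 1) (ball 0 1) := fun z hz =>
    mem_ball_zero_iff.mpr (norm_discInvolution_lt_one hp (mem_ball_zero_iff.mp hz))
  set F : ℂ → ℂ := fun z => discInvolution p (g (discInvolution p z)) with hF
  have hFd : DifferentiableOn ℂ F (ball 0 1) :=
    (differentiableOn_discInvolution hp).comp
      (hg.comp (differentiableOn_discInvolution hp) hmaps) (hm.comp hmaps)
  have hFm : Set.MapsTo F (ball 0 1) (ball 0 1) := hmaps.comp (hm.comp hmaps)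
  have hpp : discInvolution p p = 0 := by simp [discInvolution]
  have hp0 : discInvolution p 0 = p := by simp [discInvolution]
  have hF0 : F 0 = 0 := by simp [hF, hp0, hgp, hpp]
  have hq' : discInvolution p q ∈ ball (0 : ℂ) 1 := hmaps (mem_ball_zero_iff.mpr hq)
  have hqq : discInvolution p (discInvolution p q) = q := discInvolution_discInvolution hp hq
  have hq0 : discInvolution p q ≠ 0 := by
    intro h
    rw [h, hp0] at hqq
    exact hpq hqq
  have hFq : F (discInvolution p q) = discInvolution p q := by simp [hF, hqq, hgq]
  have hds : dslope F 0 (discInvolution p q) = 1 := by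
    rw [dslope_of_ne _ hq0, slope_def_field, hFq, hF0]
    simp [hq0]
  have haff := affine_of_mapsTo_ball_of_norm_dslope_eq_div (R₂ := 1) hFd
    (by rw [hF0]; exact hFm.mono_right ball_subset_closedBall) hq' (by simp [hds])
  intro z hz
  have hz1 := mem_ball_zero_iff.mp hz
  have h1 := haff (hmaps hz)
  simp only [hF0, hds, sub_zero, smul_eq_mul, mul_one, zero_add] at h1
  simp only [hF, discInvolution_discInvolution hp hz1] at h1
  have h2 := congrArg (discInvolution p) h1
  rwa [discInvolution_discInvolution hp hz1,
    discInvolution_discInvolution hp (mem_ball_zero_iff.mp (hm hz))] at h2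

/-! ### Biholomorphic self-maps of the plane -/

lemma Differentiable.dslope {f : ℂ → ℂ} (hf : Differentiable ℂ f) (c : ℂ) :
    Differentiable ℂ (dslope f c) := by
  rw [← differentiableOn_univ] at hf ⊢
  exact (differentiableOn_dslope univ_mem).mpr hf

lemma exists_norm_le_of_continuous {f : ℂ → ℂ} (hf : Continuous f) (r : ℝ) :
    ∃ C, ∀ z, ‖z‖ ≤ r → ‖f z‖ ≤ C := by
  obtain ⟨C, hC⟩ := (isCompact_closedBall (0 : ℂ) r).exists_bound_of_continuousOn hf.continuousOn
  exact ⟨C, fun z hz => hC z (mem_closedBall_zero_iff.mpr hz)⟩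

/-- The difference quotient at `0` is entire and bounded, hence constant. -/
lemma eq_affine_of_norm_le {h : ℂ → ℂ} (hd : Differentiable ℂ h) {C : ℝ}
    (hC : ∀ w, ‖h w‖ ≤ ‖w‖ + C) : ∃ s : ℂ, ∀ w, h w = h 0 + s * w := by
  obtain ⟨B, hB⟩ := exists_norm_le_of_continuous (hd.dslope 0).continuous 1
  have hb : Bornology.IsBounded (Set.range (dslope h 0)) := by
    refine isBounded_iff_forall_norm_le.mpr ⟨max B (1 + 2 * |C|), ?_⟩
    rintro _ ⟨w, rfl⟩
    rcases le_total ‖w‖ 1 with hw | hw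
    · exact (hB w hw).trans (le_max_left _ _)
    · refine le_trans ?_ (le_max_right _ _)
      have hw0 : w ≠ 0 := by
        rintro rfl
        simp at hw
        linarith
      rw [dslope_of_ne _ hw0, slope_def_field, norm_div, sub_zero,
        div_le_iff₀ (norm_pos_iff.mpr hw0)]
      have h1 := hC w
      have h2 := hC 0
      rw [norm_zero, zero_add] at h2
      have h3 := norm_sub_le (h w) (h 0)
      nlinarith [le_abs_self C, abs_nonneg C]
  refine ⟨dslope h 0 0, fun w => ?_⟩
  have h1 := (hd.dslope 0).apply_eq_apply_of_bounded hb 0 w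
  have h2 := sub_smul_dslope h 0 w
  rw [h1]
  simp only [sub_zero, smul_eq_mul] at h2
  rw [mul_comm, h2]
  ring

/-- Injectivity makes the difference quotient `k` of `f` at `0` zero-free, so `1 / k` is entire.
Since `g` is bounded on bounded sets, `f` stays away from `f 0` for large `w`, which bounds `1 / k`
linearly. So `1 / k` is affine without zeros, hence constant. -/
lemma eq_affine_of_biholomorphic {f g : ℂ → ℂ} (hf : Differentiable ℂ f)
    (hg : Differentiable ℂ g) (hgf : ∀ w, g (f w) = w) :
    ∀ w, f w = f 0 + (f 1 - f 0) * w := by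
  have hinj : Function.Injective f := Function.LeftInverse.injective hgf
  set k := dslope f 0 with hk
  have hkd : Differentiable ℂ k := hf.dslope 0
  have hfk : ∀ w, f w = f 0 + w * k w := fun w => by
    have h2 := sub_smul_dslope f 0 w
    simp only [sub_zero, smul_eq_mul] at h2
    rw [hk, h2]
    ring
  have hk0 : ∀ w, k w ≠ 0 := by
    intro w hw
    rcases eq_or_ne w 0 with rfl | hw0
    · rw [hk, dslope_same] at hw
      have h1 : HasDerivAt (g ∘ f) (deriv g (f 0) * deriv f 0) 0 :=
        (hg _).hasDerivAt.comp _ (hf 0).hasDerivAt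
      have h2 : g ∘ f = id := funext hgf
      rw [h2, hw, mul_zero] at h1
      exact zero_ne_one (h1.unique (hasDerivAt_id 0))
    · have := hfk w
      rw [hw, mul_zero, add_zero] at this
      exact hw0 (hinj this)
  have hid : Differentiable ℂ fun w => (k w)⁻¹ := fun w => (hkd w).inv (hk0 w)
  obtain ⟨M, hM⟩ := exists_norm_le_of_continuous hg.continuous (‖f 0‖ + 1)
  obtain ⟨C, hC⟩ := exists_norm_le_of_continuous hid.continuous M
  have hbound : ∀ w, ‖(k w)⁻¹‖ ≤ ‖w‖ + |C| := by
    intro w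
    by_cases hw : ‖w‖ ≤ M
    · exact (hC w hw).trans (by linarith [le_abs_self C, norm_nonneg w])
    · have h1 : ‖f 0‖ + 1 < ‖f w‖ := by
        by_contra! h
        have := hM (f w) h
        rw [hgf] at this
        exact hw this
      have h2 : 1 ≤ ‖w‖ * ‖k w‖ := by
        rw [← norm_mul]
        have h3 := norm_add_le (f 0) (w * k w)
        rw [← hfk] at h3
        linarith
      rw [norm_inv, inv_eq_one_div, div_le_iff₀ (norm_pos_iff.mpr (hk0 w))]
      nlinarith [abs_nonneg C, norm_nonneg (k w)]
  obtain ⟨s, hs⟩ := eq_affine_of_norm_le hid hbound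
  have hs0 : s = 0 := by
    by_contra hs0
    -- This point would be a zero of the affine function `1 / k`.
    have h1 := hs (-(k 0)⁻¹ / s)
    rw [mul_div_cancel₀ _ hs0, add_neg_cancel] at h1
    exact inv_ne_zero (hk0 _) h1
  have hconst : ∀ w, k w = k 0 := fun w => by
    have := hs w
    rw [hs0, zero_mul, add_zero] at this
    exact inv_injective this
  intro w
  rw [hfk w, hfk 1, hconst w, hconst 1]
  ring

/-! ### Interpolation in the disc -/

/-- A Lagrange polynomial is damped by `(z / p j) ^ n`, which is `1` at `p j` and at most `‖p j‖ ^
n` where `‖z‖ < ‖p j‖ ^ 2`. For `p j = 0` the estimate is vacuous. -/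
lemma exists_interpolation_term (p : ℕ → ℂ) (hp : Function.Injective p) (hlt : ∀ j, ‖p j‖ < 1)
    (j : ℕ) (c : ℂ) : ∃ T : ℂ → ℂ, Differentiable ℂ T ∧ (∀ i < j, T (p i) = 0) ∧ T (p j) = c ∧
      ∀ z, ‖z‖ < ‖p j‖ ^ 2 → ‖T z‖ ≤ (1 / 2) ^ j := by
  set G : ℂ → ℂ := fun z => c * ∏ i ∈ Finset.range j, (z - p i) / (p j - p i) with hG
  have hGd : Differentiable ℂ G := by fun_prop
  have hG0 : ∀ i < j, G (p i) = 0 := fun i hi => by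
    simp only [hG]
    rw [Finset.prod_eq_zero (Finset.mem_range.mpr hi) (by simp), mul_zero]
  have hG1 : G (p j) = c := by
    simp only [hG]
    rw [Finset.prod_eq_one, mul_one]
    intro i hi
    exact div_self (sub_ne_zero.mpr fun h => (Finset.mem_range.mp hi).ne (hp h).symm)
  rcases eq_or_ne (p j) 0 with h0 | h0
  · refine ⟨G, hGd, hG0, hG1, fun z hz => ?_⟩
    simp only [h0, norm_zero, ne_eq, OfNat.ofNat_ne_zero, not_false_eq_true, zero_pow] at hz
    exact absurd hz (norm_nonneg z).not_gt
  obtain ⟨A, hA⟩ := exists_norm_le_of_continuous hGd.continuous 1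
  have hlim : Tendsto (fun n : ℕ => A * ‖p j‖ ^ n) atTop (𝓝 (A * 0)) :=
    (tendsto_pow_atTop_nhds_zero_of_lt_one (norm_nonneg _) (hlt j)).const_mul A
  rw [mul_zero] at hlim
  obtain ⟨n, hn⟩ := (hlim.eventually_le_const (show (0 : ℝ) < (1 / 2) ^ j by positivity)).exists
  refine ⟨fun z => G z * (z / p j) ^ n, by fun_prop, fun i hi => by simp [hG0 i hi],
    by simp [hG1, h0], fun z hz => ?_⟩
  have hpos := norm_pos_iff.mpr h0
  have hz1 : ‖z‖ ≤ 1 := by nlinarith [hlt j]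
  have hq : ‖z / p j‖ ≤ ‖p j‖ := by
    rw [norm_div, div_le_iff₀ hpos]
    nlinarith
  rw [norm_mul, norm_pow]
  refine le_trans (mul_le_mul (hA z hz1) (pow_le_pow_left₀ (norm_nonneg _) hq n)
    (by positivity) ((norm_nonneg _).trans (hA z hz1))) hn

/-- On a smaller disc all but finitely many terms obey the geometric bound, as `s j → 1`. -/
lemma differentiableOn_ball_tsum {f : ℕ → ℂ → ℂ} (hf : ∀ j, Differentiable ℂ (f j)) {s : ℕ → ℝ}
    (hs : Tendsto s atTop (𝓝 1)) (hb : ∀ j z, ‖z‖ < s j → ‖f j z‖ ≤ (1 / 2) ^ j) :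
    DifferentiableOn ℂ (fun z => ∑' j, f j z) (ball 0 1) := by
  intro z₀ hz₀
  obtain ⟨r, hr0, hr1⟩ := exists_between (mem_ball_zero_iff.mp hz₀)
  obtain ⟨N, hN⟩ := (hs.eventually_const_lt hr1).exists_forall_of_atTop
  have hle : ∀ j z, z ∈ ball (0 : ℂ) r → ‖f (j + N) z‖ ≤ (1 / 2) ^ j := fun j z hz =>
    (hb (j + N) z ((mem_ball_zero_iff.mp hz).trans (hN _ (Nat.le_add_left _ _)))).trans
      (pow_le_pow_of_le_one (by norm_num) (by norm_num) (Nat.le_add_right _ _))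
  have hsum : Summable fun j : ℕ => ((1 : ℝ) / 2) ^ j := summable_geometric_two
  have htail := differentiableOn_tsum_of_summable_norm hsum
    (fun j => (hf (j + N)).differentiableOn) isOpen_ball hle
  have hhead : DifferentiableOn ℂ (fun z => ∑ j ∈ Finset.range N, f j z) (ball 0 r) :=
    DifferentiableOn.fun_sum fun j _ => (hf j).differentiableOn
  have heq : Set.EqOn (fun z => ∑' j, f j z)
      (fun z => ∑ j ∈ Finset.range N, f j z + ∑' j, f (j + N) z) (ball 0 r) := by
    intro z hz
    have h1 : Summable fun j => f (j + N) z := .of_norm_bounded hsum fun j => hle j z hz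
    exact ((summable_nat_add_iff (f := fun j => f j z) N).mp h1).sum_add_tsum_nat_add N |>.symm
  exact (((hhead.add htail).congr heq).differentiableAt
    (isOpen_ball.mem_nhds (mem_ball_zero_iff.mpr hr0))).differentiableWithinAt

/-- As in Newton interpolation, the `j`-th term corrects the partial sum at `p j` and vanishes at
the earlier nodes. -/
theorem exists_interpolation_seq (p : ℕ → ℂ) (hp : Function.Injective p) (hlt : ∀ j, ‖p j‖ < 1)
    (hlim : Tendsto (fun j => ‖p j‖) atTop (𝓝 1)) (v : ℕ → ℂ) :
    ∃ h : ℂ → ℂ, DifferentiableOn ℂ h (ball 0 1) ∧ ∀ j, h (p j) = v j := by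
  choose T hTd hT0 hT1 hTb using exists_interpolation_term p hp hlt
  let S : ℕ → ℂ → ℂ := fun n => Nat.rec 0 (fun j F => F + T j (v j - F (p j))) n
  have hS : ∀ j, S (j + 1) = S j + T j (v j - S j (p j)) := fun j => rfl
  set f : ℕ → ℂ → ℂ := fun j => T j (v j - S j (p j)) with hf
  have hsum : ∀ n z, ∑ j ∈ Finset.range n, f j z = S n z := by
    intro n z
    induction n with
    | zero => simp [S]
    | succ n ih => rw [Finset.sum_range_succ, ih, hS]; rfl
  refine ⟨fun z => ∑' j, f j z, differentiableOn_ball_tsum (s := fun j => ‖p j‖ ^ 2)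
    (fun j => hTd _ _) (by simpa using hlim.pow 2) (fun j => hTb _ _), fun j => ?_⟩
  have h1 : ∑' i, f i (p j) = ∑ i ∈ Finset.range (j + 1), f i (p j) :=
    tsum_eq_sum fun i hi => hT0 _ _ _ (by simpa using hi)
  simp only [h1, hsum, hS, Pi.add_apply, hT1]
  ring

/-! ### Discrete subsets -/

lemma IsDiscreteSubset.finite_inter {X : Type*} [TopologicalSpace X] {D K : Set X}
    (hD : IsDiscreteSubset D) (hK : IsCompact K) : (D ∩ K).Finite :=
  (hK.inter_left hD.1).finite (hD.2.mono Set.inter_subset_left)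

lemma isDiscreteSubset_of_locally_finite {X : Type*} [TopologicalSpace X] [T1Space X] {D : Set X}
    (h : ∀ x, ∃ U ∈ 𝓝 x, (D ∩ U).Finite) : IsDiscreteSubset D := by
  refine isClosed_and_discrete_iff.mpr fun x => ?_
  obtain ⟨U, hU, hfin⟩ := h x
  rw [disjoint_principal_right]
  have h1 : ((D ∩ U) \ {x})ᶜ ∈ 𝓝 x :=
    (hfin.subset Set.sdiff_subset).isClosed.compl_mem_nhds (by simp)
  filter_upwards [nhdsWithin_le_nhds hU, nhdsWithin_le_nhds h1, self_mem_nhdsWithin]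
    with y hy1 hy2 hy3 hyD
  exact hy2 ⟨⟨hyD, hy1⟩, hy3⟩

lemma IsDiscreteSubset.countable {X : Type*} [TopologicalSpace X] [SecondCountableTopology X]
    {D : Set X} (hD : IsDiscreteSubset D) : D.Countable := by
  have := hD.2.to_subtype
  exact Set.countable_coe_iff.mp (TopologicalSpace.separableSpace_iff_countable.mp inferInstance)

/-! ### The disc and the standard exhaustion -/

lemma norm_coe_disc_lt_one (z : openUnitDisc) : ‖(z : ℂ)‖ < 1 := z.2

lemma isCompact_norm_le {r : ℝ} (hr : r < 1) :
    IsCompact {z : openUnitDisc | ‖(z : ℂ)‖ ≤ r} := by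
  have he : IsEmbedding (Subtype.val : openUnitDisc → ℂ) := IsEmbedding.subtypeVal
  rw [he.isCompact_iff]
  convert isCompact_closedBall (0 : ℂ) r using 1
  ext z
  simp only [Set.mem_image, Set.mem_ofPred_eq, mem_closedBall_zero_iff]
  exact ⟨fun ⟨y, hy, h⟩ => h ▸ hy, fun h => ⟨⟨z, h.trans_lt hr⟩, h, rfl⟩⟩

lemma norm_le_mem_nhds (p : openUnitDisc) :
    ∃ r < 1, {z : openUnitDisc | ‖(z : ℂ)‖ ≤ r} ∈ 𝓝 p := by
  obtain ⟨r, h1, h2⟩ := exists_between (norm_coe_disc_lt_one p)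
  refine ⟨r, h2, ?_⟩
  have hc : ContinuousAt (fun z : openUnitDisc => ‖(z : ℂ)‖) p :=
    (continuous_norm.comp continuous_subtype_val).continuousAt
  exact hc.eventually_le_const h1

/-- The exhaustion function `1 / (1 - |z|) + |w|` of `Δ × ℂ`. -/
noncomputable def standardExhaustion (x : DiscTimesC) : ℝ≥0 :=
  (1 - ‖(x.1 : ℂ)‖₊)⁻¹ + ‖x.2‖₊

lemma one_sub_nnnorm_pos (z : openUnitDisc) : 0 < 1 - ‖(z : ℂ)‖₊ :=
  tsub_pos_of_lt (by exact_mod_cast norm_coe_disc_lt_one z)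

lemma isExhaustion_standardExhaustion : IsExhaustion standardExhaustion where
  continuous := by
    unfold standardExhaustion
    refine Continuous.add (Continuous.inv₀ (by fun_prop) fun x => (one_sub_nnnorm_pos _).ne')
      (by fun_prop)
  isCompact_sublevel c := by
    -- From `1 / (1 - ‖z‖) ≤ c` follows a bound on `‖z‖`; `c + 1` avoids inverting `0`.
    have hr : (1 - (c + 1 : ℝ)⁻¹) < 1 := sub_lt_self _ (by positivity)
    refine ((isCompact_norm_le hr).prod (isCompact_closedBall (0 : ℂ) c)).of_isClosed_subset
      (isClosed_le ?_ continuous_const) ?_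
    · unfold standardExhaustion
      refine Continuous.add (Continuous.inv₀ (by fun_prop) fun x => (one_sub_nnnorm_pos _).ne')
        (by fun_prop)
    · rintro ⟨z, w⟩ hx
      have hpos := one_sub_nnnorm_pos z
      have h1 : (1 - ‖(z : ℂ)‖₊)⁻¹ ≤ c := le_self_add.trans hx
      have h2 : ‖w‖₊ ≤ c := le_add_self.trans hx
      refine ⟨?_, mem_closedBall_zero_iff.mpr (by exact_mod_cast h2)⟩
      have hz := norm_coe_disc_lt_one z
      have h3 : (1 - ‖(z : ℂ)‖)⁻¹ ≤ c := by
        have := NNReal.coe_le_coe.mpr h1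
        rwa [NNReal.coe_inv, NNReal.coe_sub (by exact_mod_cast hz.le)] at this
      have h4 : (c + 1 : ℝ)⁻¹ ≤ 1 - ‖(z : ℂ)‖ := by
        rw [inv_le_comm₀ (by positivity) (by linarith)]
        linarith
      simp only [Set.mem_ofPred_eq]
      linarith

theorem exists_interpolation_disc {S : Set openUnitDisc} (hinf : S.Infinite)
    (hS : IsDiscreteSubset S) (v : openUnitDisc → ℂ) :
    ∃ h : ℂ → ℂ, DifferentiableOn ℂ h (ball 0 1) ∧ ∀ p ∈ S, h p = v p := by
  have := hS.countable.to_subtype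
  have := hinf.to_subtype
  obtain ⟨e⟩ := nonempty_equiv_of_countable (α := ℕ) (β := S)
  -- Each disc of radius `r < 1` contains only finitely many points of `S`.
  have hlim : Tendsto (fun j => ‖((e j : openUnitDisc) : ℂ)‖) atTop (𝓝 1) := by
    refine tendsto_order.mpr ⟨fun r hr => ?_, fun r hr =>
      .of_forall fun j => (norm_coe_disc_lt_one _).trans hr⟩
    have hfin := hS.finite_inter (isCompact_norm_le hr)
    have h1 : {j | ‖((e j : openUnitDisc) : ℂ)‖ ≤ r}.Finite :=
      (hfin.preimage (f := fun j => (e j : openUnitDisc))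
        (Subtype.val_injective.comp e.injective).injOn).subset fun j hj => ⟨(e j).2, hj⟩
    have h2 := h1.eventually_cofinite_notMem
    rw [Nat.cofinite_eq_atTop] at h2
    filter_upwards [h2] with j hj
    exact not_le.mp hj
  obtain ⟨h, hd, hv⟩ := exists_interpolation_seq (fun j => ((e j : openUnitDisc) : ℂ))
    (Subtype.val_injective.comp (Subtype.val_injective.comp e.injective))
    (fun j => norm_coe_disc_lt_one _) hlim (fun j => v (e j))
  refine ⟨h, hd, fun p hp => ?_⟩
  have := hv (e.symm ⟨p, hp⟩)
  simpa using this

/-! ### Automorphisms of `Δ × ℂ` -/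

/-- The shear `(z, w) ↦ (z, w + h z)`. -/
noncomputable def shear (h : ℂ → ℂ) (hh : DifferentiableOn ℂ h (ball 0 1)) :
    HolAut modelDiscTimesC DiscTimesC :=
  have hs : ContMDiff modelDiscTimesC 𝓘(ℂ, ℂ) ω fun x : DiscTimesC => h x.1 := fun x => by
    have h1 : ContMDiffAt 𝓘(ℂ, ℂ) 𝓘(ℂ, ℂ) ω h (x.1 : ℂ) :=
      (hh.analyticAt (isOpen_ball.mem_nhds
        (mem_ball_zero_iff.mpr (norm_coe_disc_lt_one _)))).contDiffAt.contMDiffAt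
    exact (contMDiffAt_subtype_iff.mpr h1).comp x contMDiffAt_fst
  { toFun := fun x => (x.1, x.2 + h x.1)
    invFun := fun x => (x.1, x.2 - h x.1)
    left_inv := fun x => by simp
    right_inv := fun x => by simp
    contMDiff_toFun := contMDiff_fst.prodMk (contMDiff_snd.add hs)
    contMDiff_invFun := contMDiff_fst.prodMk (contMDiff_snd.sub hs) }

lemma shear_apply (h : ℂ → ℂ) (hh : DifferentiableOn ℂ h (ball 0 1)) (x : DiscTimesC) :
    shear h hh x = (x.1, x.2 + h x.1) := rfl

namespace HolAut

variable (φ : HolAut modelDiscTimesC DiscTimesC)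

lemma differentiable_fst_fibre (z : openUnitDisc) :
    Differentiable ℂ fun w : ℂ => ((φ (z, w)).1 : ℂ) := by
  have h1 : ContMDiff 𝓘(ℂ, ℂ) 𝓘(ℂ, ℂ) ω fun w : ℂ => ((φ (z, w)).1 : ℂ) :=
    contMDiff_subtype_val.comp
      (contMDiff_fst.comp (φ.contMDiff.comp (contMDiff_const.prodMk contMDiff_id)))
  exact h1.contDiff.differentiable (by simp)

lemma differentiable_snd_fibre (z : openUnitDisc) :
    Differentiable ℂ fun w : ℂ => (φ (z, w)).2 := by
  have h1 : ContMDiff 𝓘(ℂ, ℂ) 𝓘(ℂ, ℂ) ω fun w : ℂ => (φ (z, w)).2 :=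
    contMDiff_snd.comp (φ.contMDiff.comp (contMDiff_const.prodMk contMDiff_id))
  exact h1.contDiff.differentiable (by simp)

/-- Automorphisms preserve the fibres of the projection to the disc, by Liouville's theorem. -/
lemma fst_eq (z : openUnitDisc) (w w' : ℂ) : (φ (z, w)).1 = (φ (z, w')).1 := by
  refine Subtype.ext ((φ.differentiable_fst_fibre z).apply_eq_apply_of_bounded ?_ w w')
  refine isBounded_iff_forall_norm_le.mpr ⟨1, ?_⟩
  rintro _ ⟨u, rfl⟩
  exact (norm_coe_disc_lt_one _).le

lemma fst_eq_iff (x y : DiscTimesC) : (φ x).1 = (φ y).1 ↔ x.1 = y.1 := by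
  refine ⟨fun h => ?_, fun h => ?_⟩
  · have := HolAut.fst_eq φ.symm (φ x).1 (φ x).2 (φ y).2
    rw [Prod.mk.eta, h, Prod.mk.eta] at this
    simpa using this
  · obtain ⟨z, w⟩ := x
    obtain ⟨z', w'⟩ := y
    obtain rfl : z = z' := h
    exact φ.fst_eq z w w'

/-- The inverse automorphism, restricted to the image fibre, inverts the fibre map, so the
classification of plane biholomorphisms applies. -/
lemma snd_eq (z : openUnitDisc) (w : ℂ) :
    (φ (z, w)).2 = (φ (z, 0)).2 + ((φ (z, 1)).2 - (φ (z, 0)).2) * w := by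
  refine eq_affine_of_biholomorphic (φ.differentiable_snd_fibre z)
    (HolAut.differentiable_snd_fibre φ.symm (φ (z, 0)).1) (fun w => ?_) w
  rw [φ.fst_eq z 0 w]
  simp

/-- On a compact part of the disc, an automorphism grows at most linearly along the fibres. -/
lemma exists_standardExhaustion_le {r : ℝ} (hr : r < 1) : ∃ C : ℝ, ∀ x : DiscTimesC,
    ‖(x.1 : ℂ)‖ ≤ r → (standardExhaustion (φ x) : ℝ) ≤ C * (1 + ‖x.2‖) := by
  have hφ : Continuous φ := φ.contMDiff.continuous
  have hc (w : ℂ) : Continuous fun z : openUnitDisc => φ (z, w) :=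
    hφ.comp (continuous_id.prodMk continuous_const)
  have hρ := isExhaustion_standardExhaustion.continuous
  obtain ⟨A, hA⟩ := (isCompact_norm_le hr).exists_bound_of_continuousOn
    (f := fun z => (standardExhaustion (φ (z, 0)) : ℝ))
    (NNReal.continuous_coe.comp (hρ.comp (hc 0))).continuousOn
  obtain ⟨B, hB⟩ := (isCompact_norm_le hr).exists_bound_of_continuousOn
    (f := fun z => (φ (z, 1)).2 - (φ (z, 0)).2)
    (((continuous_snd.comp (hc 1)).sub (continuous_snd.comp (hc 0)))).continuousOn
  refine ⟨A + B, fun ⟨z, w⟩ hz => ?_⟩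
  have h1 := hA z hz
  have h2 := hB z hz
  rw [Real.norm_of_nonneg NNReal.zero_le_coe] at h1
  simp only [standardExhaustion, NNReal.coe_add, coe_nnnorm] at h1 ⊢
  rw [φ.fst_eq z w 0, φ.snd_eq z w]
  have h3 := norm_add_le (φ (z, 0)).2 (((φ (z, 1)).2 - (φ (z, 0)).2) * w)
  rw [norm_mul] at h3
  have h4 := mul_le_mul_of_nonneg_right h2 (norm_nonneg w)
  have hB0 := (norm_nonneg _).trans h2
  have hA0 : 0 ≤ A := le_trans (by positivity) h1
  nlinarith [mul_nonneg hA0 (norm_nonneg w)]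

/-- An automorphism whose base map fixes two points of the disc preserves every fibre. -/
lemma fst_eq_self {x y : DiscTimesC} (hxy : x.1 ≠ y.1) (hx : φ x = x) (hy : φ y = y)
    (u : DiscTimesC) : (φ u).1 = u.1 := by
  classical
  -- The base map, read off on the zero section; its value outside the disc is irrelevant.
  set g : ℂ → ℂ := fun z => if hz : ‖z‖ < 1 then ((φ ((⟨z, hz⟩ : openUnitDisc), 0)).1 : ℂ) else 0
    with hg
  have hgv (v : DiscTimesC) : g v.1 = (φ v).1 := by
    rw [hg]
    simp only [norm_coe_disc_lt_one v.1, dif_pos]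
    exact congrArg _ (φ.fst_eq v.1 0 v.2)
  have hgd : DifferentiableOn ℂ g (ball 0 1) := by
    intro z hz
    have h1 : ContMDiff 𝓘(ℂ, ℂ) 𝓘(ℂ, ℂ) ω fun z : openUnitDisc => ((φ (z, 0)).1 : ℂ) :=
      contMDiff_subtype_val.comp
        (contMDiff_fst.comp (φ.contMDiff.comp (contMDiff_id.prodMk contMDiff_const)))
    have h2 : (fun z : openUnitDisc => ((φ (z, 0)).1 : ℂ)) = fun z : openUnitDisc => g z :=
      funext fun z => (hgv (z, 0)).symm
    rw [h2] at h1
    have h3 := contMDiffAt_subtype_iff.mp (h1 (⟨z, mem_ball_zero_iff.mp hz⟩ : openUnitDisc))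
    exact (h3.contDiffAt.differentiableAt (by simp)).differentiableWithinAt
  have hgm : Set.MapsTo g (ball 0 1) (ball 0 1) := fun z hz => by
    have := hgv ((⟨z, mem_ball_zero_iff.mp hz⟩ : openUnitDisc), 0)
    rw [mem_ball_zero_iff]
    exact (congrArg norm this).trans_lt (norm_coe_disc_lt_one _)
  have := eqOn_id_of_two_fixedPoints hgd hgm (norm_coe_disc_lt_one x.1) (norm_coe_disc_lt_one y.1)
    (fun h => hxy (Subtype.ext h)) (by rw [hgv, hx]) (by rw [hgv, hy])
    (mem_ball_zero_iff.mpr (norm_coe_disc_lt_one u.1))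
  rw [hgv] at this
  exact Subtype.ext this

end HolAut

/-! ### Weakly tame subsets of `Δ × ℂ` -/

lemma IsWeaklyTame.finite_inter {D : Set DiscTimesC} (hD : IsWeaklyTame modelDiscTimesC D)
    {r : ℝ} (hr : r < 1) : (D ∩ {x | ‖(x.1 : ℂ)‖ ≤ r}).Finite := by
  obtain ⟨-, hdisc, ht⟩ := hD
  obtain ⟨φ, hφ⟩ := ht standardExhaustion isExhaustion_standardExhaustion
    fun x => 1 + ‖(x : DiscTimesC).2‖₊ ^ 2
  obtain ⟨C, hC⟩ := HolAut.exists_standardExhaustion_le φ hr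
  refine (hdisc.finite_inter
    ((isCompact_norm_le hr).prod (isCompact_closedBall (0 : ℂ) (2 * |C| + 1)))).subset ?_
  rintro x ⟨hxD, hx⟩
  refine ⟨hxD, hx, mem_closedBall_zero_iff.mpr ?_⟩
  have h1 := hC x hx
  have h2 := NNReal.coe_le_coe.mpr (hφ ⟨x, hxD⟩)
  push_cast at h2
  by_contra! h
  have h3 := le_abs_self C
  have h4 := abs_nonneg C
  nlinarith [mul_le_mul_of_nonneg_right h3 (norm_nonneg x.2),
    mul_pos (sub_pos.mpr h) (show 0 < ‖x.2‖ by linarith)]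

lemma IsWeaklyTame.isDiscreteSubset_image {D : Set DiscTimesC}
    (hD : IsWeaklyTame modelDiscTimesC D) : IsDiscreteSubset (Prod.fst '' D) := by
  refine isDiscreteSubset_of_locally_finite fun p => ?_
  obtain ⟨r, hr, hU⟩ := norm_le_mem_nhds p
  refine ⟨_, hU, ((hD.finite_inter hr).image Prod.fst).subset ?_⟩
  rintro _ ⟨⟨x, hx, rfl⟩, hxr⟩
  exact ⟨x, ⟨hx, hxr⟩, rfl⟩

lemma IsWeaklyTame.finite_fibre {D : Set DiscTimesC}
    (hD : IsWeaklyTame modelDiscTimesC D) (p : openUnitDisc) : {x ∈ D | x.1 = p}.Finite :=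
  (hD.finite_inter (norm_coe_disc_lt_one p)).subset
    fun _ hx => ⟨hx.1, (congrArg (fun z : openUnitDisc => ‖(z : ℂ)‖) hx.2).le⟩

lemma finite_of_finite_image_fst {D : Set DiscTimesC}
    (hfib : ∀ p : openUnitDisc, {x ∈ D | x.1 = p}.Finite) {T : Set openUnitDisc} (hT : T.Finite) :
    (D ∩ Prod.fst ⁻¹' T).Finite :=
  (hT.biUnion fun p _ => hfib p).subset fun _ hx =>
    Set.mem_biUnion hx.2 ⟨hx.1, rfl⟩

lemma isDiscreteSubset_of_image_fst {D : Set DiscTimesC} (hS : IsDiscreteSubset (Prod.fst '' D))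
    (hfib : ∀ p : openUnitDisc, {x ∈ D | x.1 = p}.Finite) : IsDiscreteSubset D := by
  refine isDiscreteSubset_of_locally_finite fun x => ?_
  obtain ⟨r, hr, hU⟩ := norm_le_mem_nhds x.1
  refine ⟨_, continuous_fst.continuousAt hU,
    (finite_of_finite_image_fst hfib (hS.finite_inter (isCompact_norm_le hr))).subset ?_⟩
  rintro y ⟨hy, hyr⟩
  exact ⟨hy, ⟨y, hy, rfl⟩, hyr⟩

lemma infinite_image_fst {D : Set DiscTimesC} (hinf : D.Infinite)
    (hfib : ∀ p : openUnitDisc, {x ∈ D | x.1 = p}.Finite) : (Prod.fst '' D).Infinite := fun h =>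
  hinf ((finite_of_finite_image_fst hfib h).subset fun x hx => ⟨hx, x, hx, rfl⟩)

lemma IsExhaustion.exists_bound_fibre {ρ : DiscTimesC → ℝ≥0} (hρ : IsExhaustion ρ) (c : ℝ≥0) :
    ∃ R : ℝ, ∀ x : DiscTimesC, R < ‖x.2‖ → c ≤ ρ x := by
  obtain ⟨R, hR⟩ := (hρ.isCompact_sublevel c).exists_bound_of_continuousOn
    (f := Prod.snd) continuous_snd.continuousOn
  refine ⟨R, fun x hx => ?_⟩
  by_contra! h
  exact (hR x h.le).not_gt hx

theorem isWeaklyTame_of_image_fst {D : Set DiscTimesC} (hinf : D.Infinite)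
    (hS : IsDiscreteSubset (Prod.fst '' D))
    (hfib : ∀ p : openUnitDisc, {x ∈ D | x.1 = p}.Finite) : IsWeaklyTame modelDiscTimesC D := by
  classical
  refine ⟨hinf, isDiscreteSubset_of_image_fst hS hfib, fun ρ hρ ζ => ?_⟩
  choose R hR using hρ.exists_bound_fibre
  let Z : DiscTimesC → ℝ≥0 := fun x => if hx : x ∈ D then ζ ⟨x, hx⟩ else 0
  have hB (p : openUnitDisc) : ∃ B : ℝ, 0 ≤ B ∧ ∀ x ∈ D, x.1 = p → R (Z x) + ‖x.2‖ < B := by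
    obtain ⟨B, hB⟩ := ((hfib p).image fun x => R (Z x) + ‖x.2‖).bddAbove
    refine ⟨max B 0 + 1, by positivity, fun x hx hxp => ?_⟩
    have := hB ⟨x, ⟨hx, hxp⟩, rfl⟩
    have := le_max_left B 0
    simp only at *
    linarith
  choose B hB0 hB using hB
  obtain ⟨h, hd, hv⟩ := exists_interpolation_disc (infinite_image_fst hinf hfib) hS
    fun p => (B p : ℂ)
  refine ⟨shear h hd, fun ⟨x, hx⟩ => ?_⟩
  have hZ : Z x = ζ ⟨x, hx⟩ := dif_pos hx
  rw [← hZ]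
  refine hR _ _ ?_
  rw [shear_apply, hv x.1 ⟨x, hx, rfl⟩]
  have h1 := hB x.1 x hx rfl
  have h2 := norm_sub_le (x.2 + (B x.1 : ℂ)) x.2
  rw [add_sub_cancel_left, Complex.norm_of_nonneg (hB0 _)] at h2
  simp only
  linarith

/-! ### Strongly tame subsets -/

lemma IsDiscreteSubset.exists_injective {X : Type*} [TopologicalSpace X]
    [SecondCountableTopology X] {D : Set X} (hinf : D.Infinite) (hD : IsDiscreteSubset D)
    {ρ : X → ℝ≥0} (hρ : IsExhaustion ρ) (ζ : D → ℝ≥0) :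
    ∃ f : D → D, Function.Injective f ∧ ∀ x, ζ x ≤ ρ (f x) := by
  have := hD.countable.to_subtype
  have := hinf.to_subtype
  obtain ⟨e⟩ := nonempty_equiv_of_countable (α := ℕ) (β := D)
  obtain ⟨k, hk, hkζ⟩ := extraction_forall_of_eventually
    (P := fun n m => ζ (e n) ≤ ρ (e m)) fun n => by
      have hfin := hD.finite_inter (hρ.isCompact_sublevel (ζ (e n)))
      have h1 := (hfin.preimage (f := fun j => (e j : X))
        (Subtype.val_injective.comp e.injective).injOn).eventually_cofinite_notMem
      rw [Nat.cofinite_eq_atTop] at h1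
      filter_upwards [h1] with m hm
      by_contra! h
      exact hm ⟨(e m).2, h.le⟩
  refine ⟨fun x => e (k (e.symm x)),
    e.injective.comp (hk.injective.comp e.symm.injective), fun x => ?_⟩
  have := hkζ (e.symm x)
  rwa [e.apply_symm_apply] at this

lemma IsStronglyTame.isWeaklyTame {E H X : Type*} [NormedAddCommGroup E] [NormedSpace ℂ E]
    [TopologicalSpace H] {I : ModelWithCorners ℂ E H} [TopologicalSpace X] [ChartedSpace H X]
    [SecondCountableTopology X] {D : Set X} (hD : IsStronglyTame I D) : IsWeaklyTame I D := by
  obtain ⟨hinf, hdisc, hf⟩ := hD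
  refine ⟨hinf, hdisc, fun ρ hρ ζ => ?_⟩
  obtain ⟨f, hfi, hfζ⟩ := hdisc.exists_injective hinf hρ ζ
  obtain ⟨φ, hφ⟩ := hf f hfi
  exact ⟨φ, fun x => by rw [hφ]; exact hfζ x⟩

theorem IsWeaklyTame.exists_perm {D : Set DiscTimesC} (hD : IsWeaklyTame modelDiscTimesC D) :
    ∃ σ : Equiv.Perm D, ¬ ∃ φ : HolAut modelDiscTimesC DiscTimesC,
      ∀ x : D, φ (x : DiscTimesC) = (σ x : DiscTimesC) := by
  classical
  let e := (infinite_image_fst hD.1 hD.finite_fibre).natEmbedding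
  choose x hxD hx using fun n => (e n).2
  have hinj {m n : ℕ} (h : (x m).1 = (x n).1) : m = n :=
    e.injective (Subtype.ext (by rw [← hx m, ← hx n, h]))
  let y : ℕ → D := fun n => ⟨x n, hxD n⟩
  have hy {m n : ℕ} (h : m ≠ n) : y m ≠ y n := fun h' =>
    h (hinj (congrArg (fun u : D => (u : DiscTimesC).1) h'))
  refine ⟨Equiv.swap (y 2) (y 3), fun ⟨φ, hφ⟩ => ?_⟩
  have h0 := hφ (y 0)
  have h1 := hφ (y 1)
  have h2 := hφ (y 2)
  rw [Equiv.swap_apply_of_ne_of_ne (hy (by decide)) (hy (by decide))] at h0 h1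
  rw [Equiv.swap_apply_left] at h2
  have h3 := HolAut.fst_eq_self φ (fun h => absurd (hinj h) (by decide)) h0 h1 (x 2)
  have h4 : (x 3).1 = (x 2).1 := (congrArg Prod.fst h2).symm.trans h3
  exact absurd (hinj h4) (by decide)

theorem not_isStronglyTame (D : Set DiscTimesC) : ¬ IsStronglyTame modelDiscTimesC D := by
  intro hD
  obtain ⟨σ, hσ⟩ := hD.isWeaklyTame.exists_perm
  exact hσ (hD.2.2 σ σ.injective)

/-! ### Examples -/

theorem isWeaklyTame_prod_zero {S : Set openUnitDisc} (hinf : S.Infinite)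
    (hS : IsDiscreteSubset S) : IsWeaklyTame modelDiscTimesC (S ×ˢ ({0} : Set ℂ)) := by
  refine isWeaklyTame_of_image_fst (hinf.prod_left (Set.singleton_nonempty 0)) ?_ fun p => ?_
  · rwa [Set.fst_image_prod _ (Set.singleton_nonempty 0)]
  · refine (Set.finite_singleton ((p, 0) : DiscTimesC)).subset ?_
    rintro ⟨z, w⟩ ⟨⟨-, hw⟩, hz⟩
    exact Prod.ext hz hw

theorem isWeaklyTame_insert {S : Set openUnitDisc} (hinf : S.Infinite)
    (hS : IsDiscreteSubset S) {s : openUnitDisc} (hs : s ∈ S) (w : ℂ) :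
    IsWeaklyTame modelDiscTimesC (insert (s, w) (S ×ˢ ({0} : Set ℂ))) := by
  refine isWeaklyTame_of_image_fst ((hinf.prod_left (Set.singleton_nonempty 0)).mono
    (Set.subset_insert _ _)) ?_ fun p => ?_
  · rwa [Set.image_insert_eq, Set.fst_image_prod _ (Set.singleton_nonempty 0),
      Set.insert_eq_of_mem hs]
  · refine (Set.toFinite {(s, w), ((p, 0) : DiscTimesC)}).subset ?_
    rintro ⟨z, w'⟩ ⟨hx | ⟨-, hw⟩, hz⟩
    · exact Or.inl hx
    · exact Or.inr (Prod.ext hz hw)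

theorem exists_infinite_isDiscreteSubset_disc :
    ∃ S : Set openUnitDisc, S.Infinite ∧ IsDiscreteSubset S := by
  have hnorm (n : ℕ) : ‖(1 - 1 / ((n : ℂ) + 1))‖ = 1 - 1 / ((n : ℝ) + 1) := by
    have h : (1 - 1 / ((n : ℂ) + 1)) = ((1 - 1 / ((n : ℝ) + 1) : ℝ) : ℂ) := by push_cast; rfl
    rw [h, Complex.norm_of_nonneg]
    rw [sub_nonneg, div_le_one (by positivity)]
    linarith [n.cast_nonneg (α := ℝ)]
  let f : ℕ → openUnitDisc := fun n => ⟨1 - 1 / ((n : ℂ) + 1), by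
    change ‖_‖ < 1
    rw [hnorm]
    exact sub_lt_self _ (by positivity)⟩
  have hf (n : ℕ) : ‖(f n : ℂ)‖ = 1 - 1 / ((n : ℝ) + 1) := hnorm n
  refine ⟨Set.range f, Set.infinite_range_of_injective fun m n h => ?_,
    isDiscreteSubset_of_locally_finite fun p => ?_⟩
  · have h1 := congrArg (fun z : openUnitDisc => ‖(z : ℂ)‖) h
    simp only [hf, one_div, sub_right_inj, inv_inj, add_left_inj, Nat.cast_inj] at h1
    exact h1
  · obtain ⟨r, hr, hU⟩ := norm_le_mem_nhds p
    refine ⟨_, hU, ((Set.finite_Iic ⌈(1 - r)⁻¹⌉₊).image f).subset ?_⟩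
    rintro _ ⟨⟨n, rfl⟩, hn⟩
    refine ⟨n, ?_, rfl⟩
    have hn' : 1 - 1 / ((n : ℝ) + 1) ≤ r := (hf n).symm.trans_le hn
    have h1 : (1 - r) ≤ ((n : ℝ) + 1)⁻¹ := by rw [← one_div]; linarith
    have h2 := (le_inv_comm₀ (by linarith) (by positivity)).mp h1
    have h3 : (n : ℝ) ≤ ⌈(1 - r)⁻¹⌉₊ := by linarith [Nat.le_ceil (1 - r)⁻¹]
    exact_mod_cast h3

theorem not_exists_image_prod_zero_eq_insert {S : Set openUnitDisc} {s : openUnitDisc}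
    (hs : s ∈ S) {w : ℂ} (hw : w ≠ 0) : ¬ ∃ φ : HolAut modelDiscTimesC DiscTimesC,
      φ '' (S ×ˢ ({0} : Set ℂ)) = insert (s, w) (S ×ˢ ({0} : Set ℂ)) := by
  rintro ⟨φ, hφ⟩
  obtain ⟨⟨a, u⟩, ⟨-, hu⟩, hau⟩ := hφ.symm.subset (Set.mem_insert _ _)
  obtain ⟨⟨b, v⟩, ⟨-, hv⟩, hbv⟩ := hφ.symm.subset
    (Set.mem_insert_of_mem _ (show (s, (0 : ℂ)) ∈ S ×ˢ ({0} : Set ℂ) from ⟨hs, rfl⟩))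
  obtain rfl : u = 0 := hu
  obtain rfl : v = 0 := hv
  obtain rfl : a = b := (HolAut.fst_eq_iff φ (a, 0) (b, 0)).mp (by rw [hau, hbv])
  exact hw (congrArg Prod.snd (hau.symm.trans hbv))

theorem mainTheorem10 :
    -- there are no strongly tame discrete subsets
    (¬ ∃ D : Set DiscTimesC, IsStronglyTame modelDiscTimesC D) ∧
    -- the weakly tame discrete subsets are exactly those with discrete projection to the disc
    -- and finite fibres
    (∀ D : Set DiscTimesC, D.Infinite → IsDiscreteSubset D →
      (IsWeaklyTame modelDiscTimesC D ↔
        IsDiscreteSubset (Prod.fst '' D) ∧ ∀ p : openUnitDisc, {x ∈ D | x.1 = p}.Finite)) ∧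
    -- in particular every infinite discrete subset of the disc gives a weakly tame one
    (∀ S : Set openUnitDisc, S.Infinite → IsDiscreteSubset S →
      IsWeaklyTame modelDiscTimesC (S ×ˢ ({0} : Set ℂ))) ∧
    -- there are inequivalent weakly tame discrete subsets
    (∃ D₁ D₂ : Set DiscTimesC,
      IsWeaklyTame modelDiscTimesC D₁ ∧ IsWeaklyTame modelDiscTimesC D₂ ∧
        ¬ ∃ φ : HolAut modelDiscTimesC DiscTimesC, φ '' D₁ = D₂) ∧
    -- there is a permutation of a weakly tame discrete subset that does not extend
    (∃ D : Set DiscTimesC, IsWeaklyTame modelDiscTimesC D ∧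
      ∃ σ : Equiv.Perm D, ¬ ∃ φ : HolAut modelDiscTimesC DiscTimesC,
        ∀ x : D, φ (x : DiscTimesC) = (σ x : DiscTimesC)) := by
  obtain ⟨S, hinf, hS⟩ := exists_infinite_isDiscreteSubset_disc
  obtain ⟨s, hs⟩ := hinf.nonempty
  have h0 := isWeaklyTame_prod_zero hinf hS
  exact ⟨fun ⟨D, hD⟩ => not_isStronglyTame D hD,
    fun D hinf _ => ⟨fun hD => ⟨hD.isDiscreteSubset_image, hD.finite_fibre⟩,
      fun h => isWeaklyTame_of_image_fst hinf h.1 h.2⟩,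
    fun S hinf hS => isWeaklyTame_prod_zero hinf hS,
    ⟨_, _, h0, isWeaklyTame_insert hinf hS hs 1,
      not_exists_image_prod_zero_eq_insert hs one_ne_zero⟩,
    ⟨_, h0, h0.exists_perm⟩⟩
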